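/- A non-negative measure $\mu$ on $\mathbb{R}$ is called admissible if it has finite moments $s_k(\mu)=\int_{\mathbb{R}} x^k\,d\mu(x)$ of all orders $k\ge 0$. For a closed set $K\subset\mathbb{R}$ let $\mathcal{M}(K)$ denote the set of moment sequences $(s_k(\mu))_{k\ge 0}$ of the admissible measures $\mu$ supported on $K$. For $F:\mathbb{R}\to\mathbb{R}$ let $F[-]$ denote the entrywise application of $F$ to sequences and matrices. An absolutely monotonic entire function is an entire function whose Taylor coefficients at every point of $(0,\infty)$ are non-negative. **Theorem.** The following are equivalent for a function $F:\mathbb{R}\to\mathbb{R}$. 1. $F[-]$ maps the sequences in $\bigcup_{u\in(0,1)}\mathcal{M}(\{-1,u,1\})$ into $\mathcal{M}(\mathbb{R})$. 2. $F[-]$ maps $\mathcal{M}([-1,1])$ into $\mathcal{M}(\mathbb{R})$. 3. $F$ is the restriction to $\mathbb{R}$ of an absolutely monotonic entire function. In particular, if $F[H]$ is positive semidefinite for every real positive semidefinite semi-infinite Hankel matrix $H=(s_{i+j})_{i,j\ge 0}$ of rank at most $3$, then (3) holds, and $F[A]$ is positive semidefinite for every real positive semidefinite matrix $A$ of any finite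 size. (A semi-infinite matrix is called positive semidefinite if it is symmetric and its quadratic form is non-negative on all finitely supported vectors.) -/

import Mathlib

open MeasureTheory
open scoped ComplexOrder

/-- A non-negative measure on the real line is admissible if it has moments of all orders. -/
def IsAdmissible (μ : Measure ℝ) : Prop :=
  ∀ k : ℕ, Integrable (fun x : ℝ => x ^ k) μ

/-- The set of moment sequences of the admissible measures supported on `K`.
A measure is supported on `K` (in the applications, a closed set) if it does not charge the
complement of `K`. -/
def momentSequences (K : Set ℝ) : Set (ℕ → ℝ) :=
  {s | ∃ μ : Measure ℝ, IsAdmissible μ ∧ μ Kᶜ = 0 ∧ ∀ k : ℕ, s k = ∫ x, x ^ k ∂μ}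

/-- `F` is the restriction to the real line of an absolutely monotonic entire function, that is,
of an entire function whose Taylor coefficients at every point of `(0, ∞)` are non-negative
(in `ℂ`, `0 ≤ z` means that `z` is real and non-negative). -/
def IsRestrictionOfAbsMonotonicEntire (F : ℝ → ℝ) : Prop :=
  ∃ G : ℂ → ℂ, Differentiable ℂ G ∧
    (∀ x : ℝ, 0 < x → ∀ n : ℕ, 0 ≤ iteratedDeriv n G (x : ℂ) / (n.factorial : ℂ)) ∧
    ∀ x : ℝ, (F x : ℂ) = G (x : ℂ)

/-- The semi-infinite Hankel matrix with first column `s`. -/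
def hankelMatrix (s : ℕ → ℝ) : Matrix ℕ ℕ ℝ :=
  Matrix.of fun i j => s (i + j)

/-!
For a measure with masses `a` at `-1` and `exp y` at `exp (-h)`, the image under `F` of its moments
alternates between `F (a + exp ·)` and `F (-a + exp ·)` along `y, y - h, y - 2 * h, …`. It is
positive semidefinite and bounded, and such sequences are stable under
`s k ↦ s k - s (k + 2)`, which here is a forward difference of step `2 * h`. Iterating shows that
`F (a + exp ·)` and `F (a + exp ·) + F (-a + exp ·)` have nonnegative differences of all orders,
so by Bernstein's theorem they are real analytic, and `F` is analytic on `(-a, ∞)` for every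
`a > 0`.

Measures on `{u, 1}` give positive semidefinite sequences `F (a + b * u ^ k)`. Testing them against
the square of a polynomial that vanishes at `1, u, …, u ^ (m - 1)` and letting `b` tend to `0` shows
that the `m`-th derivative of `F` at `a ≥ 0` is nonnegative. Hence `F` is the sum of its Taylor
series at `0`, which has nonnegative coefficients.

Conversely, if `F x = ∑ c n * x ^ n` with `c n ≥ 0`, then `F` sends the moments of a measure `μ` on
`[-1, 1]` to those of `∑ c n * μ ^ n`, with powers for multiplicative convolution, and it preserves
positive semidefiniteness of matrices by the Schur product theorem.
-/

section Convexity

open Filter Topology Set AffineMap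

variable {E : Type*} [AddCommGroup E] [Module ℝ E] {s : Set E} {g : E → ℝ}

lemma sub_lineMap_le_of_midpoint (hg : QuasiconvexOn ℝ s g)
    (hmid : ∀ x ∈ s, ∀ y ∈ s, g (midpoint ℝ x y) ≤ midpoint ℝ (g x) (g y))
    {x y : E} (hx : x ∈ s) (hy : y ∈ s) (n : ℕ) {t : ℝ} (ht : t ∈ Icc (0 : ℝ) 1) :
    g (lineMap x y t) - lineMap (g x) (g y) t ≤ |g y - g x| * (1 / 2) ^ n := by
  have hmem : ∀ {r : ℝ}, r ∈ Icc (0 : ℝ) 1 → lineMap x y r ∈ s := fun hr =>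
    hg.convex.lineMap_mem hx hy hr
  induction n generalizing t with
  | zero =>
    have hmax : g (lineMap x y t) ≤ max (g x) (g y) :=
      (hg _).segment_subset ⟨hx, le_max_left _ _⟩ ⟨hy, le_max_right _ _⟩
        (lineMap_mem_segment ℝ x y ht) |>.2
    have hmin : min (g x) (g y) ≤ lineMap (g x) (g y) t :=
      (convex_Ici (min (g x) (g y))).lineMap_mem (mem_Ici.2 (min_le_left _ _))
        (mem_Ici.2 (min_le_right _ _)) ht
    have := max_sub_min_eq_abs (g x) (g y)
    linarith
  | succ n ih =>
    rw [pow_succ]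
    rcases le_total t (1 / 2) with h | h
    · have ht' : 2 * t ∈ Icc (0 : ℝ) 1 := ⟨by linarith [ht.1], by linarith⟩
      have hm := hmid _ hx _ (hmem ht')
      have e : midpoint ℝ x (lineMap x y (2 * t)) = lineMap x y t := by
        simp only [midpoint, lineMap_apply_module, invOf_eq_inv]
        module
      rw [e] at hm
      have := ih ht'
      simp only [midpoint_eq_smul_add, lineMap_apply_module, smul_eq_mul, invOf_eq_inv] at *
      linarith
    · have ht' : 2 * t - 1 ∈ Icc (0 : ℝ) 1 := ⟨by linarith, by linarith [ht.2]⟩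
      have hm := hmid _ hy _ (hmem ht')
      have e : midpoint ℝ y (lineMap x y (2 * t - 1)) = lineMap x y t := by
        simp only [midpoint, lineMap_apply_module, invOf_eq_inv]
        module
      rw [e] at hm
      have := ih ht'
      simp only [midpoint_eq_smul_add, lineMap_apply_module, smul_eq_mul, invOf_eq_inv] at *
      linarith

lemma convexOn_of_quasiconvexOn_of_midpoint (hg : QuasiconvexOn ℝ s g)
    (hmid : ∀ x ∈ s, ∀ y ∈ s, g (midpoint ℝ x y) ≤ midpoint ℝ (g x) (g y)) :
    ConvexOn ℝ s g := by
  refine ⟨hg.convex, fun x hx y hy a b ha hb hab => ?_⟩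
  have hlim : Tendsto (fun n : ℕ => |g y - g x| * (1 / 2 : ℝ) ^ n) atTop (𝓝 0) := by
    simpa using (tendsto_pow_atTop_nhds_zero_of_lt_one (r := (1 / 2 : ℝ))
      (by norm_num) (by norm_num)).const_mul |g y - g x|
  have := ge_of_tendsto' hlim fun n =>
    sub_lineMap_le_of_midpoint hg hmid hx hy n (t := b) ⟨hb, by linarith⟩
  obtain rfl : a = 1 - b := by linarith
  simpa only [lineMap_apply_module, sub_nonpos] using this

end Convexity

section Taylor

open Filter Topology Set
open scoped ContDiff NNReal

lemma hasDerivAt_of_continuous_right_deriv {E : Type*} [NormedAddCommGroup E] [NormedSpace ℝ E]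
    [CompleteSpace E] {g d : ℝ → E} (hg : Continuous g) (hd : Continuous d)
    (hgd : ∀ x, HasDerivWithinAt g (d x) (Ioi x) x) (x : ℝ) : HasDerivAt g (d x) x := by
  have heq : ∀ t, g t = (∫ u in x..t, d u) + g x := fun t => by
    rw [intervalIntegral.integral_eq_sub_of_hasDeriv_right hg.continuousOn (fun y _ => hgd y)
      (hd.intervalIntegrable _ _), sub_add_cancel]
  exact ((hd.integral_hasStrictDerivAt x x).hasDerivAt.add_const (g x)).congr_of_eventuallyEq
    (Eventually.of_forall heq)

lemma exists_taylor_lagrange {f : ℝ → ℝ} {a x : ℝ} (hx : a ≠ x) {n : ℕ}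
    (hf : ContDiff ℝ (n + 1) f) :
    ∃ ξ ∈ uIoo a x, f x = (∑ k ∈ Finset.range (n + 1),
      iteratedDeriv k f a / k.factorial * (x - a) ^ k) +
      iteratedDeriv (n + 1) f ξ / (n + 1).factorial * (x - a) ^ (n + 1) := by
  obtain ⟨ξ, hξ, h⟩ := taylor_mean_remainder_lagrange_iteratedDeriv (n := n) hx hf.contDiffOn
  refine ⟨ξ, hξ, ?_⟩
  rw [sub_eq_iff_eq_add'] at h
  rw [h, taylor_within_apply]
  congr 1
  · refine Finset.sum_congr rfl fun k hk => ?_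
    have hk' : (k : WithTop ℕ∞) ≤ n + 1 := by exact_mod_cast (Finset.mem_range.1 hk).le
    rw [iteratedDerivWithin_eq_iteratedDeriv (uniqueDiffOn_uIcc hx)
      (hf.of_le hk').contDiffAt left_mem_uIcc, smul_eq_mul]
    ring
  · ring

lemma sum_taylor_le_of_iteratedDeriv_nonneg {f : ℝ → ℝ} (hf : ContDiff ℝ ∞ f) {a b : ℝ}
    (hab : a < b) (hpos : ∀ n, ∀ y ∈ Icc a b, 0 ≤ iteratedDeriv n f y) (n : ℕ) :
    ∑ k ∈ Finset.range n, iteratedDeriv k f a / k.factorial * (b - a) ^ k ≤ f b := by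
  have : 0 ≤ b - a := (sub_pos.2 hab).le
  obtain ⟨ξ, hξ, h⟩ := exists_taylor_lagrange hab.ne (n := n)
    (hf.of_le (by exact_mod_cast le_top))
  rw [uIoo_of_le hab.le] at hξ
  have hterm := hpos n a (left_mem_Icc.2 hab.le)
  have hrem := hpos (n + 1) ξ (Ioo_subset_Icc_self hξ)
  rw [h, Finset.sum_range_succ, add_assoc]
  exact le_add_of_nonneg_right (by positivity)

lemma taylor_term_le_of_iteratedDeriv_nonneg {f : ℝ → ℝ} (hf : ContDiff ℝ ∞ f) {a b : ℝ}
    (hab : a < b) (hpos : ∀ n, ∀ y ∈ Icc a b, 0 ≤ iteratedDeriv n f y) (n : ℕ) :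
    iteratedDeriv n f a / n.factorial * (b - a) ^ n ≤ f b := by
  have : 0 ≤ b - a := (sub_pos.2 hab).le
  refine (Finset.single_le_sum (f := fun k => iteratedDeriv k f a / k.factorial * (b - a) ^ k)
    (fun k _ => ?_) (Finset.self_mem_range_succ n)).trans
    (sum_taylor_le_of_iteratedDeriv_nonneg hf hab hpos (n + 1))
  have := hpos k a (left_mem_Icc.2 hab.le)
  positivity

lemma iteratedDeriv_nonneg_of_forall_lt_eq_zero {f : ℝ → ℝ} {n : ℕ} (hf : ContDiff ℝ n f) {a : ℝ}
    (hzero : ∀ k < n, iteratedDeriv k f a = 0) (hpos : ∀ᶠ x in 𝓝[>] a, 0 ≤ f x) :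
    0 ≤ iteratedDeriv n f a := by
  have htaylor : ∀ x, taylorWithinEval f n univ a x =
      (x - a) ^ n * (iteratedDeriv n f a / n.factorial) := fun x => by
    simp only [taylor_within_apply, iteratedDerivWithin_univ]
    rw [Finset.sum_range_succ, Finset.sum_eq_zero fun k hk => by
      rw [hzero k (Finset.mem_range.1 hk), smul_zero], zero_add, smul_eq_mul]
    ring
  have hlim : Tendsto (fun x => f x / (x - a) ^ n) (𝓝[>] a)
      (𝓝 (iteratedDeriv n f a / n.factorial)) := by
    have h := (Real.taylor_tendsto convex_univ (mem_univ a) hf.contDiffOn).mono_left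
      (nhdsWithin_mono a (subset_univ (Ioi a)))
    refine (zero_add (iteratedDeriv n f a / n.factorial) ▸ h.add_const _).congr' ?_
    filter_upwards [self_mem_nhdsWithin] with x (hx : a < x)
    have : (x - a) ^ n ≠ 0 := pow_ne_zero _ (sub_pos.2 hx).ne'
    rw [htaylor]
    field_simp
    ring
  rw [← zero_mul (n.factorial : ℝ), ← le_div_iff₀ (by positivity)]
  refine ge_of_tendsto hlim ?_
  filter_upwards [hpos, self_mem_nhdsWithin] with x hfx (hx : a < x)
  exact div_nonneg hfx (pow_nonneg (sub_pos.2 hx).le n)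

lemma hasSum_taylor_of_abs_iteratedDeriv_le {f : ℝ → ℝ} (hf : ContDiff ℝ ∞ f) {x y r C : ℝ}
    (hy : |y| < r)
    (hbound : ∀ n, ∀ ξ ∈ Metric.ball x r, |iteratedDeriv n f ξ| / n.factorial * r ^ n ≤ C) :
    HasSum (fun n => iteratedDeriv n f x / n.factorial * y ^ n) (f (x + y)) := by
  have hr : 0 < r := (abs_nonneg y).trans_lt hy
  have hq : |y| / r < 1 := (div_lt_one hr).2 hy
  have hterm : ∀ n, ∀ ξ ∈ Metric.ball x r,
      ‖iteratedDeriv n f ξ / n.factorial * y ^ n‖ ≤ C * (|y| / r) ^ n := fun n ξ hξ => by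
    rw [norm_mul, norm_div, norm_pow, Real.norm_natCast, Real.norm_eq_abs, Real.norm_eq_abs]
    calc _ = |iteratedDeriv n f ξ| / n.factorial * r ^ n * (|y| / r) ^ n := by
          rw [div_pow, mul_assoc, mul_div_cancel₀ _ (by positivity)]
      _ ≤ _ := by gcongr; exact hbound n ξ hξ
  have hsum : Summable fun n => ‖iteratedDeriv n f x / n.factorial * y ^ n‖ :=
    .of_nonneg_of_le (fun _ => norm_nonneg _) (fun n => hterm n x (Metric.mem_ball_self hr))
      ((summable_geometric_of_lt_one (by positivity) hq).mul_left C)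
  rw [hasSum_iff_tendsto_nat_of_summable_norm hsum, ← tendsto_add_atTop_iff_nat 1,
    tendsto_iff_norm_sub_tendsto_zero]
  have hlim : Tendsto (fun n : ℕ => C * (|y| / r) ^ (n + 1)) atTop (𝓝 0) := by
    simpa using ((tendsto_pow_atTop_nhds_zero_of_lt_one (by positivity) hq).comp
      (tendsto_add_atTop_nat 1)).const_mul C
  refine squeeze_zero (fun n => norm_nonneg _) (fun n => ?_) hlim
  rcases eq_or_ne y 0 with rfl | hy0
  · rw [Finset.sum_eq_single 0] <;> simp +contextual
  obtain ⟨ξ, hξ, h⟩ := exists_taylor_lagrange (a := x) (x := x + y) (by simpa using hy0) (n := n)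
    (hf.of_le (by exact_mod_cast le_top))
  rw [h, add_sub_cancel_left, sub_add_cancel_left, norm_neg]
  refine hterm (n + 1) ξ ((convex_ball x r).ordConnected.uIcc_subset (Metric.mem_ball_self hr) ?_
    (Ioo_subset_Icc_self hξ))
  simpa using hy

lemma analyticAt_of_abs_iteratedDeriv_le {f : ℝ → ℝ} (hf : ContDiff ℝ ∞ f) {x C : ℝ} {r : ℝ≥0}
    (hr : 0 < r)
    (hbound : ∀ n, ∀ ξ ∈ Metric.ball x r, |iteratedDeriv n f ξ| / n.factorial * r ^ n ≤ C) :
    AnalyticAt ℝ f x := by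
  have hball : HasFPowerSeriesOnBall f (FormalMultilinearSeries.ofScalars ℝ
      fun n => iteratedDeriv n f x / (n.factorial : ℝ)) x r := by
    refine ⟨FormalMultilinearSeries.le_radius_of_bound _ C fun n => ?_,
      by exact_mod_cast hr, fun {y} hy => ?_⟩
    · rw [FormalMultilinearSeries.ofScalars_norm, norm_div, Real.norm_natCast]
      exact hbound n x (Metric.mem_ball_self (by exact_mod_cast hr))
    · simp only [FormalMultilinearSeries.ofScalars_apply_eq, smul_eq_mul]
      refine hasSum_taylor_of_abs_iteratedDeriv_le hf (r := r) ?_ hbound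
      simpa using hy
  exact hball.analyticAt

lemma analyticAt_of_iteratedDeriv_nonneg {f : ℝ → ℝ} (hf : ContDiff ℝ ∞ f)
    (hpos : ∀ n y, 0 ≤ iteratedDeriv n f y) (x : ℝ) : AnalyticAt ℝ f x := by
  have hmono : Monotone f := monotone_of_deriv_nonneg (hf.differentiable (by simp)) fun y => by
    simpa using hpos 1 y
  refine analyticAt_of_abs_iteratedDeriv_le hf (r := 1) one_pos (C := f (x + 2)) fun n ξ hξ => ?_
  have hξ' : ξ < x + 1 := by simpa using (Real.ball_eq_Ioo x 1 ▸ hξ : ξ ∈ Ioo (x - 1) (x + 1)).2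
  rw [abs_of_nonneg (hpos n ξ)]
  calc _ = iteratedDeriv n f ξ / n.factorial * (ξ + 1 - ξ) ^ n := by simp
    _ ≤ f (ξ + 1) :=
      taylor_term_le_of_iteratedDeriv_nonneg hf (lt_add_one ξ) (fun n y _ => hpos n y) n
    _ ≤ f (x + 2) := hmono (by linarith)

end Taylor

section ForwardDifferences

open Filter Topology Set
open scoped fwdDiff ContDiff

lemma fwdDiff_nsmul {M G : Type*} [AddCommMonoid M] [AddCommGroup G] (m : ℕ) (h : M) (f : M → G) :
    fwdDiff (m • h) f = ∑ j ∈ Finset.range m, fun x => fwdDiff h f (x + j • h) := by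
  funext x
  rw [Finset.sum_apply, fwdDiff]
  simpa [fwdDiff, add_smul, add_assoc] using
    (Finset.sum_range_sub (fun j : ℕ => f (x + j • h)) m).symm

lemma fwdDiff_iter_nsmul_nonneg {M G : Type*} [AddCommMonoid M] [AddCommGroup G] [PartialOrder G]
    [IsOrderedAddMonoid G] {f : M → G} {h : M} {n : ℕ} (hf : ∀ y, 0 ≤ (fwdDiff h)^[n] f y) (m : ℕ)
    (y : M) : 0 ≤ (fwdDiff (m • h))^[n] f y := by
  induction n generalizing f y with
  | zero => exact hf y
  | succ n ih =>
    rw [Function.iterate_succ_apply]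
    refine ih (fun y => ?_) y
    rw [fwdDiff_nsmul, fwdDiff_iter_finsetSum, Finset.sum_apply]
    refine Finset.sum_nonneg fun j _ => ?_
    rw [fwdDiff_iter_comp_add h (fwdDiff h f) (j • h) n y, ← Function.iterate_succ_apply]
    exact hf _

lemma tendsto_fwdDiff_iter {M G ι : Type*} [AddCommMonoid M] [AddCommGroup G] [TopologicalSpace G]
    [IsTopologicalAddGroup G] {l : Filter ι} {f : ι → M → G} {g : M → G}
    (hf : ∀ x, Tendsto (fun i => f i x) l (𝓝 (g x))) (h : M) (n : ℕ) (y : M) :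
    Tendsto (fun i => (fwdDiff h)^[n] (f i) y) l (𝓝 ((fwdDiff h)^[n] g y)) := by
  simp only [fwdDiff_iter_eq_sum_shift]
  exact tendsto_finsetSum _ fun k _ => (hf _).const_smul _

/-- A real function has nonnegative differences if its iterated forward differences of every order
(order `0` included) and every positive step are nonnegative: Bernstein's absolutely monotone
functions on the line, with no regularity assumed. -/
def HasNonnegDifferences (g : ℝ → ℝ) : Prop :=
  ∀ h : ℝ, 0 < h → ∀ (n : ℕ) (y : ℝ), 0 ≤ (fwdDiff h)^[n] g y

namespace HasNonnegDifferences

variable {g : ℝ → ℝ}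

lemma of_tendsto {f : ℝ → ℝ → ℝ} (hf : ∀ d, 0 < d → ∀ n y, 0 ≤ (fwdDiff d)^[n] (f d) y)
    (hlim : ∀ x, Tendsto (fun d => f d x) (𝓝[>] 0) (𝓝 (g x))) : HasNonnegDifferences g := by
  intro h hh n y
  -- `h` is a multiple of the steps `h / (m + 1)`, which tend to `0`.
  have hstep : Tendsto (fun m : ℕ => h / ((m + 1 : ℕ) : ℝ)) atTop (𝓝[>] 0) :=
    tendsto_nhdsWithin_iff.2 ⟨(tendsto_const_div_atTop_nhds_zero_nat h).comp
      (tendsto_add_atTop_nat 1), Eventually.of_forall fun m => by simp only [mem_Ioi]; positivity⟩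
  refine ge_of_tendsto' (tendsto_fwdDiff_iter (fun x => (hlim x).comp hstep) h n y) fun m => ?_
  have := fwdDiff_iter_nsmul_nonneg (hf (h / (m + 1 : ℕ)) (by positivity) n) (m + 1) y
  rwa [nsmul_eq_mul, mul_div_cancel₀ h (by positivity)] at this

protected lemma nonneg (hg : HasNonnegDifferences g) (x : ℝ) : 0 ≤ g x := hg 1 one_pos 0 x

protected lemma monotone (hg : HasNonnegDifferences g) : Monotone g := fun x y hxy => by
  rcases hxy.eq_or_lt with rfl | hlt
  · rfl
  · simpa [fwdDiff] using hg (y - x) (sub_pos.2 hlt) 1 x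

protected lemma convexOn (hg : HasNonnegDifferences g) : ConvexOn ℝ univ g := by
  refine convexOn_of_quasiconvexOn_of_midpoint hg.monotone.quasiconvexOn fun x _ y _ => ?_
  wlog hxy : x ≤ y generalizing x y
  · simpa only [midpoint_comm] using this y trivial x trivial (le_of_not_ge hxy)
  rcases hxy.eq_or_lt with rfl | hlt
  · simp
  have := hg ((y - x) / 2) (by linarith) 2 x
  simp only [Function.iterate_succ, Function.iterate_zero, Function.comp_apply, fwdDiff,
    id, show x + (y - x) / 2 = (x + y) / 2 by ring,
    show (x + y) / 2 + (y - x) / 2 = y by ring] at this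
  simp only [midpoint_eq_smul_add, invOf_eq_inv, smul_eq_mul, inv_mul_eq_div]
  linarith

protected lemma continuous (hg : HasNonnegDifferences g) : Continuous g :=
  continuousOn_univ.1 (hg.convexOn.continuousOn isOpen_univ)

lemma hasDerivWithinAt (hg : HasNonnegDifferences g) (x : ℝ) :
    HasDerivWithinAt g (derivWithin g (Ioi x) x) (Ioi x) x :=
  hg.convexOn.hasDerivWithinAt_rightDeriv_of_mem_interior (by simp)

lemma rightDeriv (hg : HasNonnegDifferences g) :
    HasNonnegDifferences fun x => derivWithin g (Ioi x) x := by
  refine of_tendsto (f := fun d => d⁻¹ • fwdDiff d g) (fun d hd n y => ?_) fun x => ?_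
  · rw [fwdDiff_iter_const_smul, ← Function.iterate_succ_apply]
    exact smul_nonneg (inv_nonneg.2 hd.le) (hg d hd _ _)
  · have hshift : Tendsto (fun d => x + d) (𝓝[>] 0) (𝓝[>] x) := by
      simpa only [Tendsto, add_zero] using (map_add_left_nhdsGT (c := x) (a := (0 : ℝ))).le
    refine (((hasDerivWithinAt_iff_tendsto_slope' self_notMem_Ioi).1
      (hg.hasDerivWithinAt x)).comp hshift).congr fun d => ?_
    simp [slope, fwdDiff]

lemma hasDerivAt (hg : HasNonnegDifferences g) (x : ℝ) :
    HasDerivAt g (derivWithin g (Ioi x) x) x :=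
  hasDerivAt_of_continuous_right_deriv hg.continuous hg.rightDeriv.continuous hg.hasDerivWithinAt x

protected lemma deriv (hg : HasNonnegDifferences g) : HasNonnegDifferences (deriv g) := by
  rw [show deriv g = fun x => derivWithin g (Ioi x) x from funext fun x => (hg.hasDerivAt x).deriv]
  exact hg.rightDeriv

protected lemma iteratedDeriv (hg : HasNonnegDifferences g) (n : ℕ) :
    HasNonnegDifferences (iteratedDeriv n g) := by
  induction n with
  | zero => simpa
  | succ n ih => rw [iteratedDeriv_succ]; exact ih.deriv

protected lemma contDiff (hg : HasNonnegDifferences g) : ContDiff ℝ ∞ g :=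
  contDiff_of_differentiable_iteratedDeriv fun n _ x =>
    ((hg.iteratedDeriv n).hasDerivAt x).differentiableAt

protected lemma analyticAt (hg : HasNonnegDifferences g) (x : ℝ) : AnalyticAt ℝ g x :=
  analyticAt_of_iteratedDeriv_nonneg hg.contDiff (fun n => (hg.iteratedDeriv n).nonneg) x

end HasNonnegDifferences

end ForwardDifferences

section RieszFunctional

open Polynomial Set

/-- The Riesz functional of a sequence `s`: the linear functional on real polynomials that maps
`X ^ k` to `s k`, that is, integration against `μ` when `s` is the moment sequence of `μ`. -/
noncomputable def rieszFunctional (s : ℕ → ℝ) : ℝ[X] →ₗ[ℝ] ℝ :=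
  Polynomial.lsum fun k => s k • LinearMap.id

lemma rieszFunctional_eq_sum (s : ℕ → ℝ) (p : ℝ[X]) :
    rieszFunctional s p = ∑ k ∈ p.support, p.coeff k * s k := by
  simp [rieszFunctional, Polynomial.lsum_apply, Polynomial.sum, mul_comm]

@[simp]
lemma rieszFunctional_monomial (s : ℕ → ℝ) (k : ℕ) (c : ℝ) :
    rieszFunctional s (monomial k c) = c * s k := by
  simp [rieszFunctional, Polynomial.lsum_apply, mul_comm]

@[simp]
lemma rieszFunctional_X_pow (s : ℕ → ℝ) (k : ℕ) : rieszFunctional s (X ^ k) = s k := by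
  rw [X_pow_eq_monomial, rieszFunctional_monomial, one_mul]

@[simp]
lemma rieszFunctional_one (s : ℕ → ℝ) : rieszFunctional s 1 = s 0 := by
  simpa using rieszFunctional_X_pow s 0

@[simp]
lemma rieszFunctional_X (s : ℕ → ℝ) : rieszFunctional s X = s 1 := by
  simpa using rieszFunctional_X_pow s 1

lemma rieszFunctional_sub_shift (s : ℕ → ℝ) (j : ℕ) (p : ℝ[X]) :
    rieszFunctional (fun k => s k - s (k + j)) p = rieszFunctional s ((1 - X ^ j) * p) := by
  induction p using Polynomial.induction_on' with
  | add p q hp hq => rw [mul_add, map_add, map_add, hp, hq]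
  | monomial n a =>
    rw [sub_mul, one_mul, X_pow_mul_monomial, map_sub]
    simp only [rieszFunctional_monomial, mul_sub]

/-- A sequence is positive semidefinite if its Riesz functional is nonnegative on squares. -/
def IsPosSemidefSeq (s : ℕ → ℝ) : Prop :=
  ∀ q : ℝ[X], 0 ≤ rieszFunctional s (q * q)

lemma rieszFunctional_sum_monomial_mul_self (s : ℕ → ℝ) (x : ℕ →₀ ℝ) :
    rieszFunctional s ((∑ i ∈ x.support, monomial i (x i)) * ∑ i ∈ x.support, monomial i (x i)) =
      x.sum fun i xi => x.sum fun j xj => star xi * hankelMatrix s i j * xj := by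
  simp only [Finset.sum_mul_sum, map_sum, monomial_mul_monomial, rieszFunctional_monomial,
    Finsupp.sum, hankelMatrix, Matrix.of_apply, star_trivial]
  exact Finset.sum_congr rfl fun i _ => Finset.sum_congr rfl fun j _ => by ring

lemma posSemidef_hankelMatrix_iff {s : ℕ → ℝ} :
    (hankelMatrix s).PosSemidef ↔ IsPosSemidefSeq s := by
  refine ⟨fun h q => ?_, fun h => ⟨by ext i j; simp [hankelMatrix, add_comm], fun x => ?_⟩⟩
  · have := h.2 q.toFinsupp.coeff
    rw [← rieszFunctional_sum_monomial_mul_self] at this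
    rwa [show ∑ i ∈ q.toFinsupp.coeff.support, monomial i (q.toFinsupp.coeff i) = q from
      q.as_sum_support.symm] at this
  · rw [← rieszFunctional_sum_monomial_mul_self]
    exact h _

lemma rieszFunctional_eq_integral {μ : Measure ℝ} (hμ : IsAdmissible μ) (p : ℝ[X]) :
    rieszFunctional (fun k => ∫ x, x ^ k ∂μ) p = ∫ x, p.eval x ∂μ := by
  simp_rw [rieszFunctional_eq_sum, eval_eq_sum, Polynomial.sum]
  rw [integral_finsetSum _ fun k _ => (hμ k).const_mul _]
  simp only [integral_const_mul]

lemma isPosSemidefSeq_of_mem_momentSequences {K : Set ℝ} {s : ℕ → ℝ}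
    (hs : s ∈ momentSequences K) : IsPosSemidefSeq s := by
  obtain ⟨μ, hμ, -, hs⟩ := hs
  intro q
  rw [funext hs, rieszFunctional_eq_integral hμ]
  exact integral_nonneg fun x => by simpa using mul_self_nonneg _

lemma IsPosSemidefSeq.zero_nonneg {s : ℕ → ℝ} (hs : IsPosSemidefSeq s) : 0 ≤ s 0 := by
  simpa using hs 1

lemma IsPosSemidefSeq.two_mul_abs_one_le {s : ℕ → ℝ} (hs : IsPosSemidefSeq s) :
    2 * |s 1| ≤ s 0 + s 2 := by
  have hadd := hs (1 + X)
  have hsub := hs (1 - X)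
  rw [show (1 + X) * (1 + X) = (1 + X + X + X ^ 2 : ℝ[X]) by ring] at hadd
  rw [show (1 - X) * (1 - X) = (1 - X - X + X ^ 2 : ℝ[X]) by ring] at hsub
  simp only [map_add, map_sub, rieszFunctional_one, rieszFunctional_X, rieszFunctional_X_pow]
    at hadd hsub
  have : |s 1| ≤ (s 0 + s 2) / 2 := abs_le.2 ⟨by linarith, by linarith⟩
  linarith

/-- A bounded positive semidefinite sequence. These are the moment sequences of the measures on
`[-1, 1]`, but are used here without constructing a representing measure. -/
structure IsBoundedPosSemidef (s : ℕ → ℝ) : Prop where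
  isPosSemidefSeq : IsPosSemidefSeq s
  exists_bound : ∃ C, ∀ k, |s k| ≤ C

lemma exists_bound_rieszFunctional {s : ℕ → ℝ} (hs : ∃ C, ∀ k, |s k| ≤ C) (p : ℝ[X]) :
    ∃ C, ∀ k, |rieszFunctional s (X ^ k * p)| ≤ C := by
  induction p using Polynomial.induction_on' with
  | add p q hp hq =>
    obtain ⟨C, hC⟩ := hp
    obtain ⟨D, hD⟩ := hq
    refine ⟨C + D, fun k => ?_⟩
    rw [mul_add, map_add]
    exact (abs_add_le _ _).trans (add_le_add (hC k) (hD k))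
  | monomial n a =>
    obtain ⟨C, hC⟩ := hs
    refine ⟨|a| * C, fun k => ?_⟩
    rw [X_pow_mul_monomial, rieszFunctional_monomial, abs_mul]
    exact mul_le_mul_of_nonneg_left (hC _) (abs_nonneg a)

lemma antitone_of_two_mul_le_of_bddAbove {K : Type*} [Field K] [LinearOrder K]
    [IsStrictOrderedRing K] [Archimedean K] {a : ℕ → K}
    (hconv : ∀ m, 2 * a (m + 1) ≤ a m + a (m + 2)) (hb : BddAbove (range a)) : Antitone a := by
  obtain ⟨C, hC⟩ := hb
  refine antitone_nat_of_succ_le fun k => ?_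
  by_contra! h
  have hslope : ∀ m, a (k + 1) - a k ≤ a (k + m + 1) - a (k + m) := by
    intro m
    induction m with
    | zero => simp
    | succ m ih =>
      have : 2 * a (k + m + 1) ≤ a (k + m) + a (k + m + 1 + 1) := hconv (k + m)
      rw [← add_assoc]
      linarith
  have hlower : ∀ m : ℕ, a k + m * (a (k + 1) - a k) ≤ a (k + m) := by
    intro m
    induction m with
    | zero => simp
    | succ m ih =>
      rw [← add_assoc]
      push_cast
      linarith [hslope m]
  obtain ⟨m, hm⟩ := exists_nat_gt ((C - a k) / (a (k + 1) - a k))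
  rw [div_lt_iff₀ (sub_pos.2 h)] at hm
  linarith [hlower m, hC (mem_range_self (k + m))]

namespace IsBoundedPosSemidef

variable {s : ℕ → ℝ}

lemma one_sub_X_sq_mul (hs : IsBoundedPosSemidef s) (q : ℝ[X]) :
    0 ≤ rieszFunctional s ((1 - X ^ 2) * (q * q)) := by
  set a : ℕ → ℝ := fun m => rieszFunctional s (X ^ (2 * m) * (q * q))
  have hconv : ∀ m, 2 * a (m + 1) ≤ a m + a (m + 2) := fun m => by
    have h := hs.isPosSemidefSeq (X ^ m * q - X ^ (m + 2) * q)
    rw [show (X ^ m * q - X ^ (m + 2) * q) * (X ^ m * q - X ^ (m + 2) * q) =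
        X ^ (2 * m) * (q * q) + X ^ (2 * (m + 2)) * (q * q)
          - (2 : ℝ) • (X ^ (2 * (m + 1)) * (q * q)) by rw [two_smul]; ring,
      map_sub, map_add, map_smul, smul_eq_mul] at h
    linarith
  have hbdd : BddAbove (range a) := by
    obtain ⟨C, hC⟩ := exists_bound_rieszFunctional hs.exists_bound (q * q)
    exact ⟨C, forall_mem_range.2 fun m => (le_abs_self _).trans (hC _)⟩
  have := antitone_of_two_mul_le_of_bddAbove hconv hbdd zero_le_one
  rw [sub_mul, map_sub]
  simpa [a] using this

lemma sub_shift_two (hs : IsBoundedPosSemidef s) :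
    IsBoundedPosSemidef fun k => s k - s (k + 2) where
  isPosSemidefSeq q := by
    rw [rieszFunctional_sub_shift]
    exact hs.one_sub_X_sq_mul q
  exists_bound := by
    obtain ⟨C, hC⟩ := hs.exists_bound
    exact ⟨C + C, fun k => (abs_sub _ _).trans (add_le_add (hC _) (hC _))⟩

lemma abs_one_le_zero (hs : IsBoundedPosSemidef s) : |s 1| ≤ s 0 := by
  have := hs.isPosSemidefSeq.two_mul_abs_one_le
  have := hs.sub_shift_two.isPosSemidefSeq.zero_nonneg
  linarith

end IsBoundedPosSemidef

end RieszFunctional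

section AlternatingSamples

open Filter Topology Set
open scoped fwdDiff

/-- The sequence alternating between the values of `f` and `g` along `y, y - h, y - 2 * h, …`.
For `f = F (a + exp ·)` and `g = F (-a + exp ·)` it is the entrywise image under `F` of the moments
`a * (-1) ^ k + exp y * exp (-h) ^ k` of a measure on `{-1, exp (-h)}`. -/
noncomputable def alternatingSamples (f g : ℝ → ℝ) (h y : ℝ) (k : ℕ) : ℝ :=
  if Even k then f (y - k * h) else g (y - k * h)

variable {f g : ℝ → ℝ}

lemma alternatingSamples_fwdDiff (f g : ℝ → ℝ) (h y : ℝ) :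
    alternatingSamples (fwdDiff (2 * h) f) (fwdDiff (2 * h) g) h y =
      fun k => alternatingSamples f g h (y + 2 * h) k -
        alternatingSamples f g h (y + 2 * h) (k + 2) := by
  funext k
  have hk : y - k * h + 2 * h = y + 2 * h - k * h := by ring
  have hk' : y - k * h = y + 2 * h - ((k + 2 : ℕ) : ℝ) * h := by push_cast; ring
  have hparity : Even (k + 2) ↔ Even k := by simp [Nat.even_add]
  simp only [alternatingSamples, fwdDiff, hk, hparity]
  rw [hk']
  split_ifs <;> rfl

lemma isBoundedPosSemidef_alternatingSamples_fwdDiff_iter {h : ℝ}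
    (hfg : ∀ y, IsBoundedPosSemidef (alternatingSamples f g h y)) (n : ℕ) (y : ℝ) :
    IsBoundedPosSemidef
      (alternatingSamples ((fwdDiff (2 * h))^[n] f) ((fwdDiff (2 * h))^[n] g) h y) := by
  induction n generalizing f g y with
  | zero => exact hfg y
  | succ n ih =>
    simp only [Function.iterate_succ_apply]
    refine ih (fun y => ?_) y
    rw [alternatingSamples_fwdDiff]
    exact (hfg _).sub_shift_two

lemma abs_fwdDiff_iter_le_of_alternatingSamples {h : ℝ}
    (hfg : ∀ y, IsBoundedPosSemidef (alternatingSamples f g h y)) (n : ℕ) (y : ℝ) :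
    |(fwdDiff (2 * h))^[n] g (y - h)| ≤ (fwdDiff (2 * h))^[n] f y := by
  simpa [alternatingSamples] using
    (isBoundedPosSemidef_alternatingSamples_fwdDiff_iter hfg n y).abs_one_le_zero

lemma hasNonnegDifferences_of_alternatingSamples
    (hfg : ∀ h, 0 < h → ∀ y, IsBoundedPosSemidef (alternatingSamples f g h y)) :
    HasNonnegDifferences f := fun h hh n y => by
  have := (abs_nonneg _).trans
    (abs_fwdDiff_iter_le_of_alternatingSamples (hfg (h / 2) (half_pos hh)) n y)
  rwa [mul_div_cancel₀ h two_ne_zero] at this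

lemma hasNonnegDifferences_add_of_alternatingSamples
    (hfg : ∀ h, 0 < h → ∀ y, IsBoundedPosSemidef (alternatingSamples f g h y)) :
    HasNonnegDifferences (f + g) := by
  have hf := hasNonnegDifferences_of_alternatingSamples hfg
  refine .of_tendsto (f := fun d => (fun x => f (x + d / 2)) + g) (fun d hd n y => ?_) fun x => ?_
  · have := abs_fwdDiff_iter_le_of_alternatingSamples (hfg (d / 2) (half_pos hd)) n (y + d / 2)
    rw [mul_div_cancel₀ d two_ne_zero, add_sub_cancel_right] at this
    rw [fwdDiff_iter_add, Pi.add_apply, fwdDiff_iter_comp_add]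
    linarith [neg_abs_le ((fwdDiff d)^[n] g y)]
  · have hshift : Tendsto (fun d : ℝ => x + d / 2) (𝓝[>] 0) (𝓝 x) := by
      have : Tendsto (fun d : ℝ => x + d / 2) (𝓝 0) (𝓝 (x + 0 / 2)) :=
        Continuous.tendsto (by fun_prop) 0
      simpa using this.mono_left nhdsWithin_le_nhds
    exact ((hf.continuous.tendsto x).comp hshift).add_const (g x)

end AlternatingSamples

section TwoPointMoments

open Filter Topology Set
open scoped ContDiff

/-- The entrywise action of `F` sends the moment sequences of the measures on `{ε, u}`, where
`ε = ±1` and `0 < u ≤ 1`, to positive semidefinite sequences. -/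
def PreservesTwoPointMoments (F : ℝ → ℝ) : Prop :=
  ∀ ε ∈ ({-1, 1} : Set ℝ), ∀ u ∈ Ioc (0 : ℝ) 1, ∀ a b : ℝ, 0 ≤ a → 0 ≤ b →
    IsPosSemidefSeq fun k => F (a * ε ^ k + b * u ^ k)

lemma contDiff_rieszFunctional_comp {F : ℝ → ℝ} {n : WithTop ℕ∞} (hF : ContDiff ℝ n F) (a u : ℝ)
    (p : Polynomial ℝ) : ContDiff ℝ n fun b => rieszFunctional (fun k => F (a + b * u ^ k)) p := by
  simp only [rieszFunctional_eq_sum]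
  fun_prop

lemma iteratedDeriv_rieszFunctional_comp_zero {F : ℝ → ℝ} {n : ℕ} (hF : ContDiff ℝ n F) (a u : ℝ)
    (p : Polynomial ℝ) :
    iteratedDeriv n (fun b => rieszFunctional (fun k => F (a + b * u ^ k)) p) 0 =
      p.eval (u ^ n) * iteratedDeriv n F a := by
  have hFa : ContDiff ℝ n fun z => F (a + z) := by fun_prop
  simp only [rieszFunctional_eq_sum, mul_comm _ (u ^ _)]
  rw [iteratedDeriv_fun_sum fun k _ => by fun_prop, Polynomial.eval_eq_sum, Polynomial.sum,
    Finset.sum_mul]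
  refine Finset.sum_congr rfl fun k _ => ?_
  rw [iteratedDeriv_const_mul_field, iteratedDeriv_comp_const_mul hFa]
  simp only [iteratedDeriv_comp_const_add, mul_zero, add_zero]
  ring

namespace PreservesTwoPointMoments

variable {F : ℝ → ℝ}

lemma abs_le_of_abs_le (hF : PreservesTwoPointMoments F) {x y : ℝ} (hxy : |x| ≤ y) :
    |F x| ≤ F y := by
  obtain ⟨hneg, hpos⟩ := abs_le.1 hxy
  have h := (hF (-1) (by simp) 1 ⟨one_pos, le_rfl⟩ ((y - x) / 2) ((y + x) / 2)
    (by linarith) (by linarith)).two_mul_abs_one_le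
  simp only [pow_zero, pow_one, mul_one, neg_one_sq, one_pow] at h
  rw [show (y - x) / 2 * -1 + (y + x) / 2 = x by ring,
    show (y - x) / 2 + (y + x) / 2 = y by ring] at h
  linarith

lemma isBoundedPosSemidef_alternatingSamples_exp (hF : PreservesTwoPointMoments F) {a : ℝ}
    (ha : 0 ≤ a) {h : ℝ} (hh : 0 < h) (y : ℝ) :
    IsBoundedPosSemidef (alternatingSamples (fun x => F (a + Real.exp x))
      (fun x => F (-a + Real.exp x)) h y) := by
  have hmoments : alternatingSamples (fun x => F (a + Real.exp x)) (fun x => F (-a + Real.exp x))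
      h y = fun k => F (a * (-1) ^ k + Real.exp y * Real.exp (-h) ^ k) := by
    funext k
    have hexp : Real.exp (y - k * h) = Real.exp y * Real.exp (-h) ^ k := by
      rw [← Real.exp_nat_mul, ← Real.exp_add]; ring_nf
    rcases Nat.even_or_odd k with hk | hk
    · simp [alternatingSamples, hk, hexp, hk.neg_one_pow]
    · simp [alternatingSamples, Nat.not_even_iff_odd.2 hk, hexp, hk.neg_one_pow]
  rw [hmoments]
  have hu : Real.exp (-h) ≤ 1 := by simpa using hh.le
  refine ⟨hF _ (by simp) _ ⟨Real.exp_pos _, hu⟩ _ _ ha (Real.exp_pos _).le,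
    F (a + Real.exp y), fun k => hF.abs_le_of_abs_le ?_⟩
  refine (abs_add_le _ _).trans (add_le_add ?_ ?_)
  · simp [abs_mul, abs_of_nonneg ha]
  · rw [abs_of_nonneg (by positivity)]
    exact mul_le_of_le_one_right (Real.exp_pos _).le (pow_le_one₀ (Real.exp_pos _).le hu)

protected lemma analyticAt (hF : PreservesTwoPointMoments F) (x : ℝ) : AnalyticAt ℝ F x := by
  set a : ℝ := |x| + 1
  have hxa : 0 < x + a := by linarith [neg_abs_le x]
  have hsamples : ∀ h, 0 < h → ∀ y, IsBoundedPosSemidef (alternatingSamples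
      (fun t => F (a + Real.exp t)) (fun t => F (-a + Real.exp t)) h y) := fun h hh =>
    hF.isBoundedPosSemidef_alternatingSamples_exp (by positivity) hh
  have hexp : AnalyticAt ℝ (fun t => F (-a + Real.exp t)) (Real.log (x + a)) := by
    have hsub := ((hasNonnegDifferences_add_of_alternatingSamples hsamples).analyticAt
      (Real.log (x + a))).sub ((hasNonnegDifferences_of_alternatingSamples hsamples).analyticAt _)
    rwa [add_sub_cancel_left] at hsub
  have hlog : AnalyticAt ℝ (fun t => Real.log (t + a)) x :=
    AnalyticAt.log (analyticAt_id.add analyticAt_const) hxa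
  refine (hexp.comp_of_eq hlog rfl).congr ?_
  filter_upwards [lt_mem_nhds (show -a < x by linarith)] with t ht
  rw [Function.comp_apply, Real.exp_log (by linarith), neg_add_eq_sub, add_sub_cancel_right]

protected lemma contDiff (hF : PreservesTwoPointMoments F) {n : WithTop ℕ∞} : ContDiff ℝ n F :=
  AnalyticOnNhd.contDiff fun x _ => hF.analyticAt x

lemma iteratedDeriv_nonneg (hF : PreservesTwoPointMoments F) (m : ℕ) {a : ℝ} (ha : 0 ≤ a) :
    0 ≤ iteratedDeriv m F a := by
  -- Testing `F (a + b * u ^ k)` against the square of a polynomial that vanishes at `u ^ j` for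
  -- `j < m` isolates the `m`-th Taylor coefficient of `F` at `a` as `b` tends to `0`.
  set u : ℝ := 1 / 2
  set q : Polynomial ℝ := Lagrange.nodal (Finset.range m) fun j => u ^ j
  have hlead := iteratedDeriv_nonneg_of_forall_lt_eq_zero
    (contDiff_rieszFunctional_comp (n := m) hF.contDiff a u (q * q)) (a := 0)
    (fun j hj => by
      rw [iteratedDeriv_rieszFunctional_comp_zero hF.contDiff, Polynomial.eval_mul,
        Lagrange.eval_nodal_at_node (Finset.mem_range.2 hj), zero_mul, zero_mul])
    (by
      filter_upwards [self_mem_nhdsWithin] with b (hb : 0 < b)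
      simpa using hF 1 (by simp) u ⟨by norm_num [u], by norm_num [u]⟩ a b ha hb.le q)
  have hq : q.eval (u ^ m) ≠ 0 := Lagrange.eval_nodal_not_at_node fun j hj =>
    (pow_lt_pow_right_of_lt_one₀ (by norm_num [u]) (by norm_num [u]) (Finset.mem_range.1 hj)).ne
  rw [iteratedDeriv_rieszFunctional_comp_zero hF.contDiff, Polynomial.eval_mul] at hlead
  exact nonneg_of_mul_nonneg_right hlead (mul_self_pos.2 hq)

end PreservesTwoPointMoments

end TwoPointMoments

section PowerSeries

open Filter Topology Set
open scoped ContDiff NNReal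

/-- `F` is the sum of an everywhere convergent power series with nonnegative coefficients. -/
def HasNonnegPowerSeries (F : ℝ → ℝ) : Prop :=
  ∃ c : ℕ → ℝ, (∀ n, 0 ≤ c n) ∧ ∀ x, HasSum (fun n => c n * x ^ n) (F x)

lemma hasFPowerSeriesOnBall_ofScalars {𝕜 : Type*} [NontriviallyNormedField 𝕜] [CompleteSpace 𝕜]
    {c : ℕ → 𝕜} (hc : ∀ r : ℝ≥0, Summable fun n => ‖c n‖ * (r : ℝ) ^ n) :
    HasFPowerSeriesOnBall (fun z => ∑' n, c n * z ^ n)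
      (FormalMultilinearSeries.ofScalars 𝕜 c) 0 ⊤ := by
  have hr : (FormalMultilinearSeries.ofScalars 𝕜 c).radius = ⊤ :=
    FormalMultilinearSeries.radius_eq_top_of_summable_norm _ fun r => by
      simpa only [FormalMultilinearSeries.ofScalars_norm] using hc r
  have hsum : (FormalMultilinearSeries.ofScalars 𝕜 c).sum = fun z => ∑' n, c n * z ^ n := by
    funext z
    simp [FormalMultilinearSeries.sum, mul_comm]
  simpa only [hr, hsum] using (FormalMultilinearSeries.ofScalars 𝕜 c).hasFPowerSeriesOnBall
    (hr ▸ ENNReal.zero_lt_top)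

lemma hasNonnegPowerSeries_of_analyticAt {F : ℝ → ℝ} (hF : ∀ x, AnalyticAt ℝ F x)
    (hpos : ∀ n x, 0 ≤ x → 0 ≤ iteratedDeriv n F x) : HasNonnegPowerSeries F := by
  set c : ℕ → ℝ := fun n => iteratedDeriv n F 0 / n.factorial
  have hc : ∀ n, 0 ≤ c n := fun n => div_nonneg (hpos n 0 le_rfl) (by positivity)
  have hsmooth : ContDiff ℝ ∞ F := AnalyticOnNhd.contDiff fun x _ => hF x
  have hpartial : ∀ r : ℝ, 0 < r → Summable fun n => ‖c n‖ * r ^ n := fun r hr => by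
    refine summable_of_sum_range_le (c := F r) (fun n => by positivity) fun n => ?_
    simpa [Real.norm_of_nonneg (hc _), c] using
      sum_taylor_le_of_iteratedDeriv_nonneg hsmooth hr (fun n y hy => hpos n y hy.1) n
  have hsum : ∀ r : ℝ≥0, Summable fun n => ‖c n‖ * (r : ℝ) ^ n := fun r =>
    (hpartial (r + 1) (by positivity)).of_nonneg_of_le (fun n => by positivity)
      fun n => by gcongr; simp
  have hball := hasFPowerSeriesOnBall_ofScalars hsum
  have heq : F = fun x => ∑' n, c n * x ^ n := by
    refine AnalyticOnNhd.eq_of_eventuallyEq (z₀ := 0) (fun x _ => hF x)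
      (fun x _ => hball.analyticAt_of_mem (by simp)) ?_
    filter_upwards [(hF 0).hasFPowerSeriesAt.eventually_hasSum_sub] with x hx
    simpa [FormalMultilinearSeries.ofScalars_apply_eq, c, mul_comm] using hx.tsum_eq.symm
  refine ⟨c, hc, fun x => ?_⟩
  rw [heq]
  refine Summable.hasSum (.of_norm ?_)
  simpa only [norm_mul, norm_pow, coe_nnnorm] using hsum ‖x‖₊

lemma nonneg_of_iteratedDeriv_zero_nonneg {G : ℂ → ℂ} (hG : Differentiable ℂ G)
    (h0 : ∀ n, 0 ≤ iteratedDeriv n G 0) {z : ℂ} (hz : 0 ≤ z) : 0 ≤ G z := by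
  refine (Complex.hasSum_taylorSeries_of_entire hG 0 z).nonneg fun n => ?_
  have := h0 n
  simp only [sub_zero, smul_eq_mul]
  positivity

lemma iteratedDeriv_nonneg_of_iteratedDeriv_zero_nonneg {G : ℂ → ℂ} (hG : Differentiable ℂ G)
    (h0 : ∀ n, 0 ≤ iteratedDeriv n G 0) {z : ℂ} (hz : 0 ≤ z) (n : ℕ) :
    0 ≤ iteratedDeriv n G z := by
  induction n generalizing G with
  | zero => simpa using nonneg_of_iteratedDeriv_zero_nonneg hG h0 hz
  | succ n ih =>
    rw [iteratedDeriv_succ']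
    exact ih hG.deriv fun k => by simpa only [← iteratedDeriv_succ'] using h0 (k + 1)

lemma HasNonnegPowerSeries.isRestrictionOfAbsMonotonicEntire {F : ℝ → ℝ}
    (hF : HasNonnegPowerSeries F) : IsRestrictionOfAbsMonotonicEntire F := by
  obtain ⟨c, hc, hsum⟩ := hF
  have hball := hasFPowerSeriesOnBall_ofScalars (c := fun n => (c n : ℂ)) fun r => by
    simpa [abs_of_nonneg (hc _)] using (hsum r).summable
  set G : ℂ → ℂ := fun z => ∑' n, (c n : ℂ) * z ^ n
  have hG : Differentiable ℂ G := fun z => (hball.analyticAt_of_mem (by simp)).differentiableAt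
  have h0 : ∀ n, 0 ≤ iteratedDeriv n G 0 := fun n => by
    have hcoeff := congrFun (FormalMultilinearSeries.ofScalars_series_injective ℂ ℂ
      ((hG.analyticAt 0).hasFPowerSeriesAt.eq_formalMultilinearSeries hball.hasFPowerSeriesAt)) n
    rw [div_eq_iff (by positivity)] at hcoeff
    have := hc n
    rw [hcoeff]
    positivity
  refine ⟨G, hG, fun x hx n => div_nonneg
    (iteratedDeriv_nonneg_of_iteratedDeriv_zero_nonneg hG h0 (by exact_mod_cast hx.le) n)
    (by positivity), fun x => ?_⟩
  simpa using (Complex.hasSum_ofReal.2 (hsum x)).tsum_eq.symm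

lemma IsRestrictionOfAbsMonotonicEntire.hasNonnegPowerSeries {F : ℝ → ℝ}
    (hF : IsRestrictionOfAbsMonotonicEntire F) : HasNonnegPowerSeries F := by
  obtain ⟨G, hG, hpos, hFG⟩ := hF
  have h0 : ∀ n : ℕ, 0 ≤ iteratedDeriv n G 0 / (n.factorial : ℂ) := fun n => by
    have hcont : Continuous fun x : ℝ => iteratedDeriv n G x / (n.factorial : ℂ) :=
      ((hG.contDiff.continuous_iteratedDeriv n le_rfl).comp Complex.continuous_ofReal).div_const _
    have hlim := (hcont.tendsto 0).mono_left (nhdsWithin_le_nhds (s := Ioi 0))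
    rw [Complex.ofReal_zero] at hlim
    exact ge_of_tendsto hlim (eventually_nhdsWithin_of_forall fun x hx => hpos x hx n)
  refine ⟨fun n => (iteratedDeriv n G 0 / (n.factorial : ℂ)).re,
    fun n => (Complex.nonneg_iff.1 (h0 n)).1, fun x => ?_⟩
  rw [← Complex.hasSum_ofReal, hFG]
  refine (Complex.hasSum_taylorSeries_of_entire hG 0 x).congr_fun fun n => ?_
  rw [Complex.ofReal_mul, ← Complex.eq_re_of_ofReal_le (r := 0) (by exact_mod_cast h0 n)]
  simp only [Complex.ofReal_pow, sub_zero, smul_eq_mul]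
  ring

end PowerSeries

section MultiplicativeConvolution

open scoped NNReal

variable {M : Type*} [Monoid M] [MeasurableSpace M]

/-- The `n`-fold multiplicative convolution power of a measure on a monoid. -/
noncomputable def mconvPow (μ : Measure M) : ℕ → Measure M
  | 0 => Measure.dirac 1
  | n + 1 => (mconvPow μ n).mconv μ

instance isFiniteMeasure_mconvPow (μ : Measure M) [IsFiniteMeasure μ] (n : ℕ) :
    IsFiniteMeasure (mconvPow μ n) := by
  induction n with
  | zero => exact inferInstanceAs (IsFiniteMeasure (Measure.dirac (1 : M)))
  | succ n ih => exact Measure.finite_of_finite_mconv _ _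

/-- The power series `∑ n, c n * μ ^ n` of a measure for multiplicative convolution. -/
noncomputable def mconvSeries (c : ℕ → ℝ≥0) (μ : Measure M) : Measure M :=
  Measure.sum fun n => c n • mconvPow μ n

variable [MeasurableMul₂ M]

lemma integral_mconvPow {𝕜 : Type*} [RCLike 𝕜] (μ : Measure M) [IsFiniteMeasure μ]
    {χ : M →* 𝕜} (hχ : Measurable χ) (n : ℕ) :
    ∫ x, χ x ∂(mconvPow μ n) = (∫ x, χ x ∂μ) ^ n := by
  induction n with
  | zero => rw [mconvPow, integral_dirac' _ _ hχ.stronglyMeasurable, map_one, pow_zero]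
  | succ n ih =>
    rw [mconvPow, Measure.mconv, integral_map (by fun_prop) hχ.aestronglyMeasurable]
    simp only [map_mul]
    rw [integral_prod_mul (μ := mconvPow μ n) (ν := μ) (fun x => χ x) (fun x => χ x), ih, pow_succ]

lemma ae_mem_mconvPow {μ : Measure M} [IsFiniteMeasure μ] {S : Submonoid M}
    (hS : MeasurableSet (S : Set M)) (hμ : ∀ᵐ x ∂μ, x ∈ S) (n : ℕ) :
    ∀ᵐ x ∂(mconvPow μ n), x ∈ S := by
  induction n with
  | zero => exact (ae_dirac_iff hS).2 S.one_mem
  | succ n ih =>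
    rw [mconvPow, Measure.mconv, ae_map_iff (p := (· ∈ S)) (by fun_prop) hS]
    filter_upwards [Measure.quasiMeasurePreserving_fst.ae ih,
      Measure.quasiMeasurePreserving_snd.ae hμ] with z hz₁ hz₂
    exact S.mul_mem hz₁ hz₂

lemma ae_mem_mconvSeries {μ : Measure M} [IsFiniteMeasure μ] {S : Submonoid M}
    (hS : MeasurableSet (S : Set M)) (hμ : ∀ᵐ x ∂μ, x ∈ S) (c : ℕ → ℝ≥0) :
    ∀ᵐ x ∂(mconvSeries c μ), x ∈ S :=
  Measure.ae_sum_iff.2 fun n => Measure.ae_smul_measure (ae_mem_mconvPow hS hμ n) _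

lemma isFiniteMeasure_mconvSeries {c : ℕ → ℝ≥0} {μ : Measure M}
    [IsFiniteMeasure μ] (hsum : Summable fun n => c n * μ.real Set.univ ^ n) :
    IsFiniteMeasure (mconvSeries c μ) := by
  refine ⟨?_⟩
  have hterm : ∀ n, (c n • mconvPow μ n) Set.univ =
      ENNReal.ofReal (c n * μ.real Set.univ ^ n) := fun n => by
    have hmass : (mconvPow μ n).real Set.univ = μ.real Set.univ ^ n := by
      simpa using integral_mconvPow μ (χ := (1 : M →* ℝ)) measurable_const n
    rw [Measure.smul_apply, ENNReal.smul_def, smul_eq_mul, ENNReal.ofReal_mul (by positivity),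
      ENNReal.ofReal_coe_nnreal, ← hmass, ofReal_measureReal]
  rw [mconvSeries, Measure.sum_apply _ MeasurableSet.univ]
  simp only [hterm]
  rw [← ENNReal.ofReal_tsum_of_nonneg (fun n => by positivity) hsum]
  exact ENNReal.ofReal_lt_top

lemma hasSum_integral_mconvSeries {𝕜 : Type*} [RCLike 𝕜] {c : ℕ → ℝ≥0}
    {μ : Measure M} [IsFiniteMeasure μ] {χ : M →* 𝕜} (hχ : Measurable χ)
    (hint : Integrable χ (mconvSeries c μ)) :
    HasSum (fun n => c n • (∫ x, χ x ∂μ) ^ n) (∫ x, χ x ∂(mconvSeries c μ)) := by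
  refine (hasSum_integral_measure hint).congr_fun fun n => ?_
  rw [integral_smul_nnreal_measure, integral_mconvPow μ hχ]

end MultiplicativeConvolution

section Moments

open Set
open scoped NNReal

lemma integrable_pow_of_ae_mem_unitClosedBall {μ : Measure ℝ} [IsFiniteMeasure μ]
    (hμ : ∀ᵐ x ∂μ, x ∈ Submonoid.unitClosedBall ℝ) (k : ℕ) : Integrable (fun x => x ^ k) μ := by
  refine Integrable.of_bound (by fun_prop) 1 ?_
  filter_upwards [hμ] with x hx
  exact mem_closedBall_zero_iff.1 ((Submonoid.unitClosedBall ℝ).pow_mem hx k)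

lemma IsAdmissible.isFiniteMeasure {μ : Measure ℝ} (hμ : IsAdmissible μ) : IsFiniteMeasure μ := by
  have h := hμ 0
  simp only [pow_zero] at h
  exact (integrable_const_iff_isFiniteMeasure one_ne_zero).1 h

lemma momentSequences_mono {K L : Set ℝ} (hKL : K ⊆ L) :
    momentSequences K ⊆ momentSequences L := by
  rintro s ⟨μ, hμ, hK, hs⟩
  exact ⟨μ, hμ, measure_mono_null (compl_subset_compl.2 hKL) hK, hs⟩

theorem HasNonnegPowerSeries.comp_mem_momentSequences {F : ℝ → ℝ} (hF : HasNonnegPowerSeries F)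
    {s : ℕ → ℝ} (hs : s ∈ momentSequences (Icc (-1) 1)) :
    (fun k => F (s k)) ∈ momentSequences (Icc (-1) 1) := by
  obtain ⟨c, hc, hsum⟩ := hF
  obtain ⟨μ, hμ, hK, hs⟩ := hs
  lift c to ℕ → ℝ≥0 using hc
  have := hμ.isFiniteMeasure
  have hball : (Submonoid.unitClosedBall ℝ : Set ℝ) = Icc (-1) 1 :=
    Real.closedBall_eq_Icc.trans (by norm_num)
  have hae : ∀ᵐ x ∂μ, x ∈ Submonoid.unitClosedBall ℝ := by
    rw [← hball] at hK
    exact hK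
  have hν : ∀ᵐ x ∂(mconvSeries c μ), x ∈ Submonoid.unitClosedBall ℝ :=
    ae_mem_mconvSeries (hball ▸ measurableSet_Icc) hae c
  have := isFiniteMeasure_mconvSeries (hsum (μ.real univ)).summable
  have hint := integrable_pow_of_ae_mem_unitClosedBall hν
  refine ⟨mconvSeries c μ, hint, hball ▸ hν, fun k => (hsum (s k)).unique ?_⟩
  have hχ : Measurable (powMonoidHom k : ℝ →* ℝ) := measurable_id.pow_const k
  simpa only [hs, NNReal.smul_def, smul_eq_mul, powMonoidHom_apply] using
    hasSum_integral_mconvSeries hχ (hint k)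

lemma twoPointMoments_mem_momentSequences (p q : ℝ) {a b : ℝ} (ha : 0 ≤ a) (hb : 0 ≤ b) :
    (fun k : ℕ => a * p ^ k + b * q ^ k) ∈ momentSequences {p, q} := by
  have hint : ∀ (t r : ℝ) (k : ℕ),
      Integrable (fun x : ℝ => x ^ k) (ENNReal.ofReal t • Measure.dirac r) := fun t r k =>
    (integrable_dirac (by simp)).smul_measure ENNReal.ofReal_ne_top
  refine ⟨ENNReal.ofReal a • Measure.dirac p + ENNReal.ofReal b • Measure.dirac q,
    fun k => (hint _ _ k).add_measure (hint _ _ k), by simp, fun k => ?_⟩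
  rw [integral_add_measure (hint _ _ k) (hint _ _ k)]
  simp [integral_smul_measure, ENNReal.toReal_ofReal, ha, hb]

end Moments

section Matrices

open Set

lemma posSemidef_map_pow {ι : Type*} {A : Matrix ι ι ℝ} (hA : A.PosSemidef) (n : ℕ) :
    (A.map fun x => x ^ n).PosSemidef := by
  induction n with
  | zero =>
    refine ⟨by ext; simp, fun x => ?_⟩
    have hsq : (x.sum fun i xi => x.sum fun j xj => star xi * (A.map (· ^ 0)) i j * xj) =
        (x.sum fun _ xi => xi) * x.sum fun _ xi => xi := by
      simp [Finsupp.sum, Finset.sum_mul_sum]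
    exact hsq ▸ mul_self_nonneg _
  | succ n ih =>
    have hsucc : (A.map fun x => x ^ (n + 1)) = (A.map fun x => x ^ n).hadamard A := by
      ext i j
      simp [pow_succ]
    exact hsucc ▸ ih.hadamard hA

theorem HasNonnegPowerSeries.posSemidef_map {F : ℝ → ℝ} (hF : HasNonnegPowerSeries F)
    {ι : Type*} {A : Matrix ι ι ℝ} (hA : A.PosSemidef) : (A.map F).PosSemidef := by
  obtain ⟨c, hc, hsum⟩ := hF
  refine ⟨hA.isHermitian.map F fun x => by simp, fun x => ?_⟩
  have hx : HasSum (fun n => c n * x.sum fun i xi => x.sum fun j xj =>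
        star xi * (A.map fun t => t ^ n) i j * xj)
      (x.sum fun i xi => x.sum fun j xj => star xi * (A.map F) i j * xj) := by
    simp only [Finsupp.sum, Finset.mul_sum]
    refine hasSum_sum fun i _ => hasSum_sum fun j _ => ?_
    refine (((hsum (A i j)).mul_left (star (x i))).mul_right (x j)).congr_fun fun n => ?_
    simp only [Matrix.map_apply]
    ring
  exact hx.nonneg fun n => mul_nonneg (hc n) ((posSemidef_map_pow hA n).2 x)

lemma eRank_hankelMatrix_twoPointMoments_le (p q a b : ℝ) :
    (hankelMatrix fun k : ℕ => a * p ^ k + b * q ^ k).eRank ≤ 2 := by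
  classical
  set S : Finset (ℕ → ℝ) := {fun i => p ^ i, fun i => q ^ i}
  have hspan : Submodule.span ℝ (range (hankelMatrix fun k : ℕ => a * p ^ k + b * q ^ k).col) ≤
      Submodule.span ℝ (S : Set (ℕ → ℝ)) := by
    rw [Submodule.span_le]
    rintro _ ⟨j, rfl⟩
    have hcol : (hankelMatrix fun k : ℕ => a * p ^ k + b * q ^ k).col j =
        (a * p ^ j) • (fun i : ℕ => p ^ i) + (b * q ^ j) • (fun i : ℕ => q ^ i) := by
      funext i
      simp only [hankelMatrix, Matrix.col_apply, Matrix.of_apply, Pi.add_apply, Pi.smul_apply,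
        smul_eq_mul, pow_add]
      ring
    rw [hcol]
    exact add_mem (Submodule.smul_mem _ _ (Submodule.subset_span (by simp [S])))
      (Submodule.smul_mem _ _ (Submodule.subset_span (by simp [S])))
  have hrank : (hankelMatrix fun k : ℕ => a * p ^ k + b * q ^ k).cRank ≤ (2 : ℕ) :=
    (Submodule.rank_mono hspan).trans ((rank_span_finset_le S).trans
      (by exact_mod_cast Finset.card_le_two))
  exact (OrderHomClass.mono Cardinal.toENat hrank).trans_eq (map_natCast _ 2)

end Matrices

lemma exists_pair_subset_triple {ε u : ℝ} (hε : ε ∈ ({-1, 1} : Set ℝ))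
    (hu : u ∈ Set.Ioc (0 : ℝ) 1) :
    ∃ v ∈ Set.Ioo (0 : ℝ) 1, ({ε, u} : Set ℝ) ⊆ {-1, v, 1} := by
  have hε' : ∀ v, ε ∈ ({-1, v, 1} : Set ℝ) := fun v => by
    rcases hε with rfl | rfl <;> simp
  rcases hu.2.eq_or_lt with rfl | hu1
  · exact ⟨1 / 2, by norm_num, Set.pair_subset (hε' _) (by simp)⟩
  · exact ⟨u, ⟨hu.1, hu1⟩, Set.pair_subset (hε' _) (by simp)⟩

lemma PreservesTwoPointMoments.hasNonnegPowerSeries {F : ℝ → ℝ} (hF : PreservesTwoPointMoments F) :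
    HasNonnegPowerSeries F :=
  hasNonnegPowerSeries_of_analyticAt hF.analyticAt fun n _ hx => hF.iteratedDeriv_nonneg n hx

theorem theorem4p1_general (F : ℝ → ℝ) :
    List.TFAE
      [ ∀ s ∈ ⋃ u ∈ Set.Ioo (0 : ℝ) 1, momentSequences {-1, u, 1},
          (fun k => F (s k)) ∈ momentSequences Set.univ,
        ∀ s ∈ momentSequences (Set.Icc (-1) 1),
          (fun k => F (s k)) ∈ momentSequences Set.univ,
        IsRestrictionOfAbsMonotonicEntire F,
        ∀ ε ∈ ({-1, 1} : Set ℝ), ∀ u ∈ Set.Ioc (0 : ℝ) 1, ∀ s ∈ momentSequences {ε, u},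
          (hankelMatrix fun k => F (s k)).PosSemidef,
        ∀ s : ℕ → ℝ, (hankelMatrix s).PosSemidef → (hankelMatrix s).eRank ≤ 2 →
          ((hankelMatrix s).map F).PosSemidef,
        ∀ (ι : Type) (A : Matrix ι ι ℝ), A.PosSemidef → (A.map F).PosSemidef ] := by
  tfae_have 3 → 2 := fun h s hs =>
    momentSequences_mono (Set.subset_univ _) (h.hasNonnegPowerSeries.comp_mem_momentSequences hs)
  tfae_have 2 → 1 := fun h s hs => by
    obtain ⟨u, hu, hs⟩ := Set.mem_iUnion₂.1 hs
    refine h s (momentSequences_mono ?_ hs)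
    rintro x (rfl | rfl | rfl)
    exacts [by norm_num, ⟨by linarith [hu.1], hu.2.le⟩, by norm_num]
  tfae_have 1 → 4 := fun h ε hε u hu s hs => by
    obtain ⟨v, hv, hsub⟩ := exists_pair_subset_triple hε hu
    exact posSemidef_hankelMatrix_iff.2 (isPosSemidefSeq_of_mem_momentSequences
      (h s (Set.mem_biUnion hv (momentSequences_mono hsub hs))))
  tfae_have 4 → 3 := fun h =>
    (PreservesTwoPointMoments.hasNonnegPowerSeries fun ε hε u hu a b ha hb =>
      posSemidef_hankelMatrix_iff.1 (h ε hε u hu _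
        (twoPointMoments_mem_momentSequences ε u ha hb))).isRestrictionOfAbsMonotonicEntire
  tfae_have 3 → 6 := fun h _ _ hA => h.hasNonnegPowerSeries.posSemidef_map hA
  tfae_have 6 → 5 := fun h s hs _ => h ℕ _ hs
  tfae_have 5 → 3 := fun h =>
    (PreservesTwoPointMoments.hasNonnegPowerSeries fun ε _ u _ a b ha hb =>
      posSemidef_hankelMatrix_iff.1 (h _ (posSemidef_hankelMatrix_iff.2
        (isPosSemidefSeq_of_mem_momentSequences (twoPointMoments_mem_momentSequences ε u ha hb)))
        (eRank_hankelMatrix_twoPointMoments_le ε u a b))).isRestrictionOfAbsMonotonicEntire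
  tfae_finish

theorem theorem4p1 (F : ℝ → ℝ) :
    List.TFAE
      [ ∀ s ∈ ⋃ u ∈ Set.Ioo (0 : ℝ) 1, momentSequences {-1, u, 1},
          (fun k => F (s k)) ∈ momentSequences Set.univ,
        ∀ s ∈ momentSequences (Set.Icc (-1) 1),
          (fun k => F (s k)) ∈ momentSequences Set.univ,
        IsRestrictionOfAbsMonotonicEntire F ] ∧
    ((∀ s : ℕ → ℝ, (hankelMatrix s).PosSemidef → (hankelMatrix s).eRank ≤ 3 →
        ((hankelMatrix s).map F).PosSemidef) →
      IsRestrictionOfAbsMonotonicEntire F ∧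
        ∀ (n : ℕ) (A : Matrix (Fin n) (Fin n) ℝ), A.PosSemidef → (A.map F).PosSemidef) := by
  have H := theorem4p1_general F
  refine ⟨fun p hp q hq => H p (List.mem_append_left [_, _, _] hp) q (List.mem_append_left _ hq),
    fun h => ?_⟩
  have hF := (H.out 4 2 rfl rfl).1 fun s hs hr => h s hs (hr.trans (by norm_num))
  exact ⟨hF, fun n A => (H.out 2 5 rfl rfl).1 hF (Fin n) A⟩
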